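/- Let $(X,d)$ be a compact metric space and let $C(X)$ be the C$^*$-algebra of continuous functions $X\to\mathbb{C}$. For a C$^*$-algebra $\mathcal{A}$ let $\mathrm{Ideals}(\mathcal{A})$ be the set of norm-closed two-sided ideals of $\mathcal{A}$, and let $\mathrm{Cl}(Y)$ be the set of all closed subsets (including $\emptyset$) of a topological space $Y$. The set $\mathrm{Prim}(\mathcal{A})$ of primitive ideals consists of the kernels of the nonzero irreducible $^*$-representations of $\mathcal{A}$ on complex Hilbert spaces. Its Jacobson topology is the one whose closed sets are the sets $\mathrm{hull}(I)=\{J\in\mathrm{Prim}(\mathcal{A}) : J\supseteq I\}$, $I\in\mathrm{Ideals}(\mathcal{A})$. For a topological space $Y$, the Fell topology on $\mathrm{Cl}(Y)$ is generated by the sets \[ U(K,F)=\{C\in\mathrm{Cl}(Y) : C\cap K=\emptyset \text{ and } C\cap V\neq\emptyset\text{ for all } V\in F\}, \] where $K\subseteq Y$ is compact and $F$ is a finite family of non-empty open subsets of $Y$. The Fell topology on $\mathrm{Ideals}(\mathcal{A})$ is the initial topology induced by the map $\mathrm{Ideals}(\mathcal{A})\to\mathrm{Cl}(\mathrm{Prim}(\mathcal{A}))$,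 $I\mapsto\mathrm{hull}(I)$, and the Fell topology on $\mathrm{Cl}(\mathrm{Prim}(\mathcal{A}))$. Let $\Phi:\mathrm{Cl}(X)\to\mathrm{Ideals}(C(X))$ be the bijection $\Phi(A)=\{f\in C(X) : f(a)=0\text{ for all }a\in A\}$. For $Y,Z\in\mathrm{Cl}(X)$ let \[ d_H(Y,Z)=\max\Big\{\sup_{x\in Y}\inf_{z\in Z}d(x,z),\ \sup_{z\in Z}\inf_{y\in Y}d(y,z)\Big\}\in[0,\infty], \] with suprema and infima taken in $[0,\infty]$ (so $\inf\emptyset=\infty$ and $\sup\emptyset=0$), and for $I,J\in\mathrm{Ideals}(C(X))$ let \[ d_{H,I}(I,J)=d_H\big(\Phi^{-1}(I),\Phi^{-1}(J)\big). \] Then $d_{H,I}$ is a metric on $\mathrm{Ideals}(C(X))$ with values in $[0,\infty]$; the value $d_{H,I}(I,J)$ is infinite exactly when one and only one of $I$, $J$ is equal to $C(X)$; and the topology on $\mathrm{Ideals}(C(X))$ induced by $d_{H,I}$ is the Fell topology. -/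

import Mathlib

open scoped ENNReal

universe u

namespace FellHausdorff

/-- An ideal of a C*-algebra: a norm-closed two-sided algebraic ideal. -/
@[ext]
structure ClosedIdeal (A : Type u) [NonUnitalCStarAlgebra A] where
  toSubmodule : Submodule ℂ A
  mul_mem_left : ∀ (a : A) {x : A}, x ∈ toSubmodule → a * x ∈ toSubmodule
  mul_mem_right : ∀ (a : A) {x : A}, x ∈ toSubmodule → x * a ∈ toSubmodule
  isClosed : IsClosed (toSubmodule : Set A)

section General

variable {A : Type u} [NonUnitalCStarAlgebra A]

/-- A star-representation of `A` on a Hilbert space `H` is irreducible if the only closed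
subspaces of `H` that are invariant under all the operators `π a` are `0` and `H`. -/
def IsIrreducibleRep {H : Type u} [NormedAddCommGroup H] [InnerProductSpace ℂ H]
    [CompleteSpace H] (π : A →⋆ₙₐ[ℂ] (H →L[ℂ] H)) : Prop :=
  ∀ K : Submodule ℂ H, IsClosed (K : Set H) → (∀ a : A, ∀ v ∈ K, π a v ∈ K) → K = ⊥ ∨ K = ⊤

/-- `J` is primitive if it is the kernel of a nonzero irreducible star-representation on a Hilbert
space. An irreducible representation is cyclic, so its space may be taken in the universe of `A`. -/
def ClosedIdeal.IsPrimitive (J : ClosedIdeal A) : Prop :=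
  ∃ (H : Type u) (_ : NormedAddCommGroup H) (_ : InnerProductSpace ℂ H) (_ : CompleteSpace H)
    (π : A →⋆ₙₐ[ℂ] (H →L[ℂ] H)),
    IsIrreducibleRep π ∧ π ≠ 0 ∧ ∀ a : A, a ∈ J.toSubmodule ↔ π a = 0

variable (A) in
/-- The set `Prim(A)` of primitive ideals, as a type. -/
def Prim : Type u := {J : ClosedIdeal A // J.IsPrimitive}

/-- The set of primitive ideals that contain `I`. -/
def hull (I : ClosedIdeal A) : Set (Prim A) := {J | I.toSubmodule ≤ J.1.toSubmodule}

/-- The ideal `A`. -/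
def ClosedIdeal.whole (A : Type u) [NonUnitalCStarAlgebra A] : ClosedIdeal A where
  toSubmodule := ⊤
  mul_mem_left _ _ _ := trivial
  mul_mem_right _ _ _ := trivial
  isClosed := isClosed_univ

/-- The intersection of a family of ideals. -/
def ClosedIdeal.sInf (S : Set (ClosedIdeal A)) : ClosedIdeal A where
  toSubmodule := ⨅ K ∈ S, K.toSubmodule
  mul_mem_left a x hx := by
    simp only [Submodule.mem_iInf] at hx ⊢
    exact fun K hK => K.mul_mem_left a (hx K hK)
  mul_mem_right a x hx := by
    simp only [Submodule.mem_iInf] at hx ⊢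
    exact fun K hK => K.mul_mem_right a (hx K hK)
  isClosed := by
    simp only [Submodule.coe_iInf]
    exact isClosed_biInter fun K _ => K.isClosed

theorem ClosedIdeal.mem_sInf {S : Set (ClosedIdeal A)} {x : A} :
    x ∈ (ClosedIdeal.sInf S).toSubmodule ↔ ∀ K ∈ S, x ∈ K.toSubmodule := by
  simp [ClosedIdeal.sInf, Submodule.mem_iInf]

theorem ClosedIdeal.IsPrimitive.exists_notMem {J : ClosedIdeal A} (hJ : J.IsPrimitive) :
    ∃ a, a ∉ J.toSubmodule := by
  obtain ⟨H, _, _, _, π, -, h0, hk⟩ := hJ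
  by_contra! h
  exact h0 (by ext a : 1; simpa using (hk a).1 (h a))

/-- Primitive ideals are prime. -/
theorem ClosedIdeal.IsPrimitive.prime {J : ClosedIdeal A} (hJ : J.IsPrimitive)
    {I₁ I₂ : ClosedIdeal A}
    (h : ∀ x, x ∈ I₁.toSubmodule → x ∈ I₂.toSubmodule → x ∈ J.toSubmodule) :
    I₁.toSubmodule ≤ J.toSubmodule ∨ I₂.toSubmodule ≤ J.toSubmodule := by
  obtain ⟨H, _, _, _, π, hirr, -, hk⟩ := hJ
  -- the vectors annihilated by `I₁` form a closed invariant subspace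
  let K : Submodule ℂ H := ⨅ x ∈ I₁.toSubmodule, LinearMap.ker (π x : H →ₗ[ℂ] H)
  have hK : ∀ v, v ∈ K ↔ ∀ x ∈ I₁.toSubmodule, π x v = 0 := by
    intro v; simp [K, Submodule.mem_iInf]
  have hcl : IsClosed (K : Set H) := by
    have : (K : Set H) = ⋂ x ∈ I₁.toSubmodule, {v | π x v = 0} := by
      ext v; simp [hK]
    rw [this]
    exact isClosed_biInter fun x _ => isClosed_eq (π x).continuous continuous_const
  have hinv : ∀ a : A, ∀ v ∈ K, π a v ∈ K := by
    intro a v hv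
    rw [hK] at hv ⊢
    intro x hx
    have := hv (x * a) (I₁.mul_mem_right a hx)
    simpa [map_mul] using this
  rcases hirr K hcl hinv with hb | ht
  · right
    intro y hy
    rw [hk]
    ext v
    have : π y v ∈ K := by
      rw [hK]
      intro x hx
      have := (hk (x * y)).1 (h _ (I₁.mul_mem_right y hx) (I₂.mul_mem_left x hy))
      rw [map_mul] at this
      simpa using congrArg (fun T : H →L[ℂ] H => T v) this
    rw [hb] at this
    simpa using this
  · left
    intro x hx
    rw [hk]
    ext v
    have : v ∈ K := by rw [ht]; trivial
    simpa using (hK v).1 this x hx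

/-- The Jacobson topology: the closed sets are exactly the hulls of ideals. (The ideal is
automatically unique, since every ideal is the intersection of the primitive ideals that
contain it.) -/
instance jacobsonTopology : TopologicalSpace (Prim A) :=
  TopologicalSpace.ofClosed {F | ∃ I : ClosedIdeal A, F = hull I}
    ⟨ClosedIdeal.whole A, by
      ext J
      obtain ⟨a, ha⟩ := J.2.exists_notMem
      simp only [Set.mem_empty_iff_false, false_iff]
      exact fun h => ha (h trivial)⟩
    (by
      intro S hS
      refine ⟨ClosedIdeal.sInf
        {K | ∀ I : ClosedIdeal A, hull I ∈ S → I.toSubmodule ≤ K.toSubmodule}, ?_⟩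
      ext J
      constructor
      · intro hJ x hx
        refine ClosedIdeal.mem_sInf.1 hx J.1 fun I hI => ?_
        exact hJ (hull I) hI
      · intro hJ F hF
        obtain ⟨I, rfl⟩ := hS hF
        intro x hx
        exact hJ (ClosedIdeal.mem_sInf.2 fun K hK => hK I hF hx))
    (by
      rintro _ ⟨I₁, rfl⟩ _ ⟨I₂, rfl⟩
      refine ⟨ClosedIdeal.sInf {I₁, I₂}, ?_⟩
      ext J
      constructor
      · rintro (h | h) x hx
        · exact h (ClosedIdeal.mem_sInf.1 hx I₁ (by simp))
        · exact h (ClosedIdeal.mem_sInf.1 hx I₂ (by simp))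
      · intro h
        refine J.2.prime fun x h₁ h₂ => h (ClosedIdeal.mem_sInf.2 ?_)
        rintro K (rfl | rfl)
        · exact h₁
        · exact h₂)

theorem isClosed_iff_hull (F : Set (Prim A)) :
    IsClosed F ↔ ∃ I : ClosedIdeal A, F = hull I :=
  isOpen_compl_iff.symm.trans <| by
    change (∃ I : ClosedIdeal A, Fᶜᶜ = hull I) ↔ _
    rw [compl_compl]

/-- The map `I ↦ {J ∈ Prim(A) : J ⊇ I}` from the ideals of `A` to the closed subsets of
`Prim(A)`. -/
def fell (I : ClosedIdeal A) : TopologicalSpace.Closeds (Prim A) :=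
  ⟨hull I, (isClosed_iff_hull _).2 ⟨I, rfl⟩⟩

end General

/-- The set `U(K, F)` of the closed sets that miss `K` and meet every member of `F`. -/
def fellBasic {Y : Type u} [TopologicalSpace Y] (K : Set Y) (F : Set (Set Y)) :
    Set (TopologicalSpace.Closeds Y) :=
  {C | (C : Set Y) ∩ K = ∅ ∧ ∀ V ∈ F, ((C : Set Y) ∩ V).Nonempty}

/-- The Fell topology on the closed subsets of an arbitrary topological space, generated by the
sets `U(K, F)` with `K` compact and `F` a finite family of nonempty open sets. -/
abbrev closedsFellTopology (Y : Type u) [TopologicalSpace Y] :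
    TopologicalSpace (TopologicalSpace.Closeds Y) :=
  TopologicalSpace.generateFrom
    {W | ∃ (K : Set Y) (F : Set (Set Y)), IsCompact K ∧ F.Finite ∧
      (∀ V ∈ F, IsOpen V ∧ V.Nonempty) ∧ W = fellBasic K F}

/-- The Fell topology on the ideals of a C*-algebra. -/
abbrev fellTopology (A : Type u) [NonUnitalCStarAlgebra A] : TopologicalSpace (ClosedIdeal A) :=
  TopologicalSpace.induced fell (closedsFellTopology (Prim A))

section Commutative

variable {X : Type u} [MetricSpace X] [CompactSpace X]

/-- The ideal `I(C)` of the functions in `C(X)` that vanish on the closed set `C`. -/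
def vanishingIdeal (C : TopologicalSpace.Closeds X) : ClosedIdeal C(X, ℂ) where
  toSubmodule :=
    { carrier := {f | ∀ x ∈ C, f x = 0}
      add_mem' := fun hf hg x hx => by simp [hf x hx, hg x hx]
      zero_mem' := fun _ _ => rfl
      smul_mem' := fun c f hf x hx => by simp [hf x hx] }
  mul_mem_left a f hf x hx := by simp [show f x = 0 from hf x hx]
  mul_mem_right a f hf x hx := by simp [show f x = 0 from hf x hx]
  isClosed := by
    have : {f : C(X, ℂ) | ∀ x ∈ C, f x = 0} = ⋂ x ∈ C, {f : C(X, ℂ) | f x = 0} := by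
      ext f; simp
    change IsClosed {f : C(X, ℂ) | ∀ x ∈ C, f x = 0}
    rw [this]
    exact isClosed_biInter fun x _ =>
      isClosed_eq (continuous_eval_const x) continuous_const

theorem vanishingIdeal_bijective :
    Function.Bijective (vanishingIdeal : TopologicalSpace.Closeds X → ClosedIdeal C(X, ℂ)) := by
  have key : ∀ (C : TopologicalSpace.Closeds X) (f : C(X, ℂ)),
      f ∈ (vanishingIdeal C).toSubmodule ↔
        f ∈ ContinuousMap.idealOfSet ℂ ((C : Set X)ᶜ) := by
    intro C f
    simp only [ContinuousMap.mem_idealOfSet, compl_compl]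
    exact Iff.rfl
  constructor
  · intro C D h
    have h' : ContinuousMap.idealOfSet ℂ ((C : Set X)ᶜ)
        = ContinuousMap.idealOfSet ℂ ((D : Set X)ᶜ) := by
      ext f
      rw [← key, ← key, h]
    have h'' := congrArg ContinuousMap.setOfIdeal h'
    rw [ContinuousMap.setOfIdeal_ofSet_eq_interior, ContinuousMap.setOfIdeal_ofSet_eq_interior,
      C.isClosed.isOpen_compl.interior_eq, D.isClosed.isOpen_compl.interior_eq,
      compl_inj_iff] at h''
    exact TopologicalSpace.Closeds.ext h''
  · intro I
    let I' : Ideal C(X, ℂ) :=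
      { carrier := I.toSubmodule
        add_mem' := fun hf hg => I.toSubmodule.add_mem hf hg
        zero_mem' := I.toSubmodule.zero_mem
        smul_mem' := fun c f hf => I.mul_mem_left c hf }
    have hI' : IsClosed (I' : Set C(X, ℂ)) := I.isClosed
    refine ⟨⟨(ContinuousMap.setOfIdeal I')ᶜ,
      (ContinuousMap.setOfIdeal_open I').isClosed_compl⟩, ?_⟩
    ext f
    rw [key]
    simp only [TopologicalSpace.Closeds.coe_mk, compl_compl]
    rw [ContinuousMap.idealOfSet_ofIdeal_isClosed hI']
    exact Iff.rfl

variable (X) in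
/-- The bijection `C ↦ I(C)` between the closed subsets of `X` and the ideals of `C(X)`. -/
noncomputable def closedsEquivIdeals : TopologicalSpace.Closeds X ≃ ClosedIdeal C(X, ℂ) :=
  Equiv.ofBijective vanishingIdeal vanishingIdeal_bijective

/-- The Hausdorff distance on the closed subsets of `X`, carried over to the ideals of `C(X)`.
It takes values in `[0, ∞]`: the distance from a point to the empty set is `∞`. -/
noncomputable def idealHausdorffDist (I J : ClosedIdeal C(X, ℂ)) : ℝ≥0∞ :=
  Metric.hausdorffEDist ((closedsEquivIdeals X).symm I : Set X)
    ((closedsEquivIdeals X).symm J : Set X)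

end Commutative

/-- `d` is a metric that may take the value `∞`. -/
structure IsExtendedMetric {T : Type u} (d : T → T → ℝ≥0∞) : Prop where
  eq_zero_iff : ∀ x y, d x y = 0 ↔ x = y
  symm : ∀ x y, d x y = d y x
  triangle : ∀ x y z, d x z ≤ d x y + d y z

/-- The topology induced by a distance function `d`: a set is open if with each of its points it
contains a ball of positive radius around the point. -/
abbrev distTopology {T : Type u} (d : T → T → ℝ≥0∞) : TopologicalSpace T where
  IsOpen U := ∀ x ∈ U, ∃ ε : ℝ≥0∞, 0 < ε ∧ {y | d x y < ε} ⊆ U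
  isOpen_univ _ _ := ⟨1, one_pos, Set.subset_univ _⟩
  isOpen_inter U V hU hV x hx := by
    obtain ⟨ε, hε, h₁⟩ := hU x hx.1
    obtain ⟨δ, hδ, h₂⟩ := hV x hx.2
    exact ⟨min ε δ, lt_min hε hδ, fun y (hy : d x y < min ε δ) =>
      ⟨h₁ (hy.trans_le (min_le_left _ _)), h₂ (hy.trans_le (min_le_right _ _))⟩⟩
  isOpen_sUnion S hS x hx := by
    obtain ⟨U, hU, hxU⟩ := hx
    obtain ⟨ε, hε, h⟩ := hS U hU x hxU
    exact ⟨ε, hε, h.trans (Set.subset_sUnion_of_mem hU)⟩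

end FellHausdorff

/-! Both topologies come from the closed subsets of `X`. A primitive ideal is prime, so the closed
set it corresponds to is irreducible, hence a point. Points are thus identified with primitive
ideals, and the hull of the ideal of `C` with `C` itself (`hull_vanishingIdeal`). This makes `X`
homeomorphic to `Prim C(X, ℂ)` and turns the Fell topology on ideals into that of `Closeds X`. In a
compact Hausdorff space the compact sets are the complements of the open ones, so the Fell topology
is the Vietoris topology, which on compact sets is given by the Hausdorff distance. The metric
axioms are inherited from `Closeds X`; infinite values arise only from the empty set. -/

namespace FellHausdorff

open TopologicalSpace Topology Set

/-! ### The Fell topology on closed sets. -/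

/-- Over a compact Hausdorff uniform space the Fell topology is the topology of the Hausdorff
uniformity. -/
theorem closedsFellTopology_eq_hausdorff (Y : Type u) [UniformSpace Y] [CompactSpace Y]
    [T2Space Y] :
    closedsFellTopology Y = (Closeds.uniformSpace (α := Y)).toTopologicalSpace := by
  have hV : (Closeds.uniformSpace (α := Y)).toTopologicalSpace =
      .induced (fun C : Closeds Y => (C : Set Y)) (.vietoris Y) := by
    -- On `Set Y` the two neighbourhood filters are known to agree only at compact sets, so the
    -- comparison is made point by point.
    refine TopologicalSpace.ext_nhds fun C => ?_
    rw [@nhds_induced _ _ (.vietoris Y), ← C.isClosed.isCompact.nhds_hausdorff_eq_nhds_vietoris]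
    let := UniformSpace.hausdorff Y
    exact Closeds.isUniformEmbedding_coe.isEmbedding.isInducing.nhds_eq_comap C
  rw [hV]
  apply le_antisymm
  · let : TopologicalSpace (Closeds Y) := closedsFellTopology Y
    rw [TopologicalSpace.vietoris, induced_generateFrom_eq]
    refine le_generateFrom ?_
    rintro _ ⟨_, ⟨U, hU, rfl⟩ | ⟨V, hV, rfl⟩, rfl⟩
    · refine isOpen_generateFrom_of_mem
        ⟨Uᶜ, ∅, IsClosed.isCompact (isClosed_compl_iff.2 hU), finite_empty, by simp, ?_⟩
      ext C
      simp [fellBasic, ← disjoint_iff_inter_eq_empty, disjoint_compl_right_iff_subset]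
    -- The Fell generators allow only nonempty `V`; for `V = ∅` the Vietoris generator is empty.
    · rcases V.eq_empty_or_nonempty with rfl | hne
      · simp
      · refine isOpen_generateFrom_of_mem
          ⟨∅, {V}, isCompact_empty, finite_singleton V, ?_, ?_⟩
        · rintro _ rfl
          exact ⟨hV, hne⟩
        · ext C
          simp [fellBasic]
  · let := TopologicalSpace.vietoris Y
    let : TopologicalSpace (Closeds Y) :=
      .induced (fun C : Closeds Y => (C : Set Y)) (.vietoris Y)
    refine le_generateFrom ?_
    rintro _ ⟨K, F, hK, hF, hFo, rfl⟩
    have hc : Continuous (fun C : Closeds Y => (C : Set Y)) := continuous_induced_dom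
    have : fellBasic K F = (fun C : Closeds Y => (C : Set Y)) ⁻¹' (Kᶜ).powerset ∩
        ⋂ V ∈ F, (fun C : Closeds Y => (C : Set Y)) ⁻¹' {s | (s ∩ V).Nonempty} := by
      ext C
      simp [fellBasic, ← disjoint_iff_inter_eq_empty, subset_compl_iff_disjoint_right]
    rw [this]
    -- The Hausdorff property enters here, to make `K` closed.
    exact (hK.isClosed.isOpen_compl.powerset_vietoris.preimage hc).inter <|
      hF.isOpen_biInter fun V hV =>
        (vietoris.isOpen_inter_nonempty_of_isOpen (hFo V hV).1).preimage hc

/-- The Fell topology is transported by homeomorphisms. -/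
theorem induced_closedsFellTopology {Y Z : Type u} [TopologicalSpace Y] [TopologicalSpace Z]
    (e : Y ≃ₜ Z) (g : Closeds Y → Closeds Z) (hg : ∀ C, (g C : Set Z) = e '' C) :
    (closedsFellTopology Z).induced g = closedsFellTopology Y := by
  have key : ∀ (K : Set Z) (F : Set (Set Z)),
      g ⁻¹' fellBasic K F = fellBasic (e ⁻¹' K) ((e ⁻¹' ·) '' F) := by
    intro K F
    ext C
    simp [fellBasic, hg, image_inter_nonempty_iff, ← not_nonempty_iff_eq_empty]
  rw [closedsFellTopology, induced_generateFrom_eq]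
  congr 1
  ext W
  constructor
  · rintro ⟨_, ⟨K, F, hK, hF, hFo, rfl⟩, rfl⟩
    refine ⟨_, _, (e.isCompact_preimage).2 hK, hF.image _, ?_, key K F⟩
    rintro _ ⟨V, hV, rfl⟩
    exact ⟨(hFo V hV).1.preimage e.continuous, (hFo V hV).2.preimage e.surjective⟩
  · rintro ⟨K, F, hK, hF, hFo, rfl⟩
    refine ⟨_, ⟨e '' K, (e '' ·) '' F, hK.image e.continuous, hF.image _, ?_, rfl⟩, ?_⟩
    · rintro _ ⟨V, hV, rfl⟩
      exact ⟨e.isOpenMap V (hFo V hV).1, (hFo V hV).2.image e⟩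
    · rw [key, image_image]
      simp [e.injective.preimage_image]

/-! ### Points of `X` as primitive ideals of `C(X, ℂ)`. -/

/-- Evaluation at a point, as a representation on a one-dimensional Hilbert space. -/
noncomputable def evalRep {X : Type u} [TopologicalSpace X] (x : X) :
    C(X, ℂ) →⋆ₙₐ[ℂ] (EuclideanSpace ℂ PUnit.{u + 1} →L[ℂ] EuclideanSpace ℂ PUnit.{u + 1}) :=
  ((StarAlgHom.ofId ℂ _).comp (ContinuousMap.evalStarAlgHom ℂ ℂ x)).toNonUnitalStarAlgHom

theorem evalRep_eq_zero_iff {X : Type u} [TopologicalSpace X] (x : X) (f : C(X, ℂ)) :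
    evalRep x f = 0 ↔ f x = 0 :=
  map_eq_zero_iff
    (algebraMap ℂ (EuclideanSpace ℂ PUnit.{u + 1} →L[ℂ] EuclideanSpace ℂ PUnit.{u + 1}))
    (algebraMap ℂ _).injective

section Commutative

variable {X : Type u} [MetricSpace X] [CompactSpace X]

theorem mem_vanishingIdeal {C : Closeds X} {f : C(X, ℂ)} :
    f ∈ (vanishingIdeal C).toSubmodule ↔ ∀ x ∈ C, f x = 0 := Iff.rfl

/-- Injectivity of `vanishingIdeal` suffices: if the inclusion holds, `C ⊔ D` and `C` have the same
ideal. -/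
theorem vanishingIdeal_le_iff {C D : Closeds X} :
    (vanishingIdeal C).toSubmodule ≤ (vanishingIdeal D).toSubmodule ↔ D ≤ C := by
  refine ⟨fun h => ?_, fun h f hf x hx => hf x (h hx)⟩
  have : vanishingIdeal (C ⊔ D) = vanishingIdeal C := by
    ext f
    refine ⟨fun hf x hx => hf x (Or.inl hx), fun hf x hx => ?_⟩
    rcases hx with hx | hx
    exacts [hf x hx, h hf x hx]
  exact sup_eq_left.1 (vanishingIdeal_bijective.1 this)

theorem vanishingIdeal_bot :
    vanishingIdeal (⊥ : Closeds X) = ClosedIdeal.whole C(X, ℂ) := by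
  ext f
  exact ⟨fun _ => trivial, fun _ x hx => hx.elim⟩

theorem symm_eq_bot_iff (I : ClosedIdeal C(X, ℂ)) :
    (closedsEquivIdeals X).symm I = ⊥ ↔ I = ClosedIdeal.whole C(X, ℂ) := by
  rw [Equiv.symm_apply_eq, ← vanishingIdeal_bot]
  rfl

theorem isPrimitive_vanishingIdeal_singleton (x : X) :
    (vanishingIdeal ({x} : Closeds X)).IsPrimitive := by
  refine ⟨EuclideanSpace ℂ PUnit.{u + 1}, inferInstance, inferInstance, inferInstance,
    evalRep x, ?_, ?_, ?_⟩
  · intro K _ _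
    have : IsSimpleOrder (Submodule ℂ (EuclideanSpace ℂ PUnit.{u + 1})) :=
      is_simple_module_of_finrank_eq_one (finrank_euclideanSpace.trans (by simp))
    exact eq_bot_or_eq_top K
  · intro h
    have : evalRep x (1 : C(X, ℂ)) = 0 := by rw [h]; rfl
    simp [evalRep_eq_zero_iff] at this
  · intro f
    rw [evalRep_eq_zero_iff, mem_vanishingIdeal]
    exact ⟨fun h => h x rfl, fun h y hy => by obtain rfl : y = x := hy; exact h⟩

/-- Primeness makes the corresponding closed set irreducible, so by the Hausdorff property it has at
most one point; properness of `J` makes it nonempty. -/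
theorem ClosedIdeal.IsPrimitive.exists_eq_vanishingIdeal_singleton {J : ClosedIdeal C(X, ℂ)}
    (hJ : J.IsPrimitive) : ∃ x, vanishingIdeal ({x} : Closeds X) = J := by
  obtain ⟨C, rfl⟩ := vanishingIdeal_bijective.2 J
  have hne : (C : Set X).Nonempty := by
    obtain ⟨f, hf⟩ := hJ.exists_notMem
    by_contra h
    rw [not_nonempty_iff_eq_empty] at h
    exact hf fun x hx => (h.subset hx).elim
  have hirr : IsPreirreducible (C : Set X) := by
    rw [isPreirreducible_iff_isClosed_union_isClosed]
    intro D E hD hE hC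
    have := hJ.prime (I₁ := vanishingIdeal ⟨D, hD⟩) (I₂ := vanishingIdeal ⟨E, hE⟩)
      fun f hf hg x hx => (hC hx).elim (hf x) (hg x)
    rw [vanishingIdeal_le_iff, vanishingIdeal_le_iff] at this
    exact this
  obtain ⟨x, hx⟩ := hne
  refine ⟨x, congrArg _ (Closeds.ext ?_)⟩
  exact (hirr.subsingleton.eq_singleton_of_mem hx).symm

/-- The primitive ideal of the functions that vanish at a point. -/
def pointIdeal (x : X) : Prim C(X, ℂ) :=
  ⟨vanishingIdeal {x}, isPrimitive_vanishingIdeal_singleton x⟩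

theorem pointIdeal_bijective : Function.Bijective (pointIdeal (X := X)) := by
  refine ⟨fun x y h => ?_, fun J => ?_⟩
  · have := congrArg (fun C : Closeds X => (C : Set X))
      (vanishingIdeal_bijective.1 (congrArg Subtype.val h))
    exact singleton_injective this
  · obtain ⟨x, hx⟩ := J.2.exists_eq_vanishingIdeal_singleton
    exact ⟨x, Subtype.ext hx⟩

theorem hull_vanishingIdeal (C : Closeds X) : hull (vanishingIdeal C) = pointIdeal '' C := by
  ext J
  obtain ⟨x, rfl⟩ := pointIdeal_bijective.2 J
  rw [pointIdeal_bijective.1.mem_set_image]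
  change (vanishingIdeal C).toSubmodule ≤ (vanishingIdeal {x}).toSubmodule ↔ _
  rw [vanishingIdeal_le_iff]
  exact singleton_subset_iff

variable (X) in
/-- The space of primitive ideals of `C(X)` is homeomorphic to `X`. -/
noncomputable def homeomorphPrim : X ≃ₜ Prim C(X, ℂ) :=
  (Equiv.ofBijective pointIdeal pointIdeal_bijective).toHomeomorphOfContinuousClosed
    (continuous_iff_isClosed.2 fun F hF => by
      obtain ⟨I, rfl⟩ := (isClosed_iff_hull F).1 hF
      obtain ⟨C, rfl⟩ := vanishingIdeal_bijective.2 I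
      rw [hull_vanishingIdeal]
      change IsClosed (pointIdeal ⁻¹' (pointIdeal '' (C : Set X)))
      rw [preimage_image_eq _ pointIdeal_bijective.1]
      exact C.isClosed)
    fun C hC => (isClosed_iff_hull _).2
      ⟨vanishingIdeal (X := X) ⟨C, hC⟩, (hull_vanishingIdeal ⟨C, hC⟩).symm⟩

/-! ### The Hausdorff distance on ideals. -/

theorem idealHausdorffDist_eq (I J : ClosedIdeal C(X, ℂ)) :
    idealHausdorffDist I J =
      edist ((closedsEquivIdeals X).symm I) ((closedsEquivIdeals X).symm J) := rfl

theorem isExtendedMetric_idealHausdorffDist :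
    IsExtendedMetric (idealHausdorffDist (X := X)) where
  eq_zero_iff I J := by simp [idealHausdorffDist_eq]
  symm I J := edist_comm (α := Closeds X) _ _
  triangle I J K := edist_triangle (α := Closeds X) _ _ _

/-- The whole algebra corresponds to `∅`, which is at infinite distance from every nonempty set;
nonempty compact sets are bounded, hence at finite distance. -/
theorem idealHausdorffDist_ne_top_iff (I J : ClosedIdeal C(X, ℂ)) :
    idealHausdorffDist I J ≠ ∞ ↔
      (I = ClosedIdeal.whole C(X, ℂ) ↔ J = ClosedIdeal.whole C(X, ℂ)) := by
  rw [← symm_eq_bot_iff, ← symm_eq_bot_iff, idealHausdorffDist]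
  generalize (closedsEquivIdeals X).symm I = C
  generalize (closedsEquivIdeals X).symm J = D
  have h : ∀ E : Closeds X, E = ⊥ ↔ (E : Set X) = ∅ := fun E => by
    rw [← Closeds.coe_bot, SetLike.coe_set_eq]
  rw [h, h]
  constructor
  · intro hfin
    rcases Metric.empty_or_nonempty_of_hausdorffEDist_ne_top hfin with h | h
    · exact iff_of_true h.1 h.2
    · exact iff_of_false h.1.ne_empty h.2.ne_empty
  · intro hCD
    rcases (C : Set X).eq_empty_or_nonempty with hC | hC
    · simp [hC, hCD.1 hC]
    · exact Metric.hausdorffEDist_ne_top_of_nonempty_of_bounded hC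
        (nonempty_iff_ne_empty.2 fun hD => hC.ne_empty (hCD.2 hD))
        C.isClosed.isCompact.isBounded D.isClosed.isCompact.isBounded

theorem distTopology_idealHausdorffDist :
    distTopology (idealHausdorffDist (X := X)) =
      (Closeds.uniformSpace (α := X)).toTopologicalSpace.induced (closedsEquivIdeals X).symm := by
  -- Written as a coinduced topology, openness of `U` is openness of its preimage in `Closeds X`,
  -- where the ball criterion applies.
  rw [← Equiv.coinduced_symm]
  ext U
  rw [isOpen_coinduced, EMetric.isOpen_iff]
  let e := closedsEquivIdeals X
  constructor
  · intro hU C hC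
    obtain ⟨ε, hε, h⟩ := hU (e C) hC
    refine ⟨ε, hε, fun D hD => h ?_⟩
    change edist (e.symm (e C)) (e.symm (e D)) < ε
    -- `distTopology` has the centre as first argument and `Metric.eball` as second, hence
    -- `edist_comm`.
    rwa [e.symm_apply_apply, e.symm_apply_apply, edist_comm]
  · intro hU I hI
    obtain ⟨ε, hε, h⟩ := hU (e.symm I) (by simpa [e] using hI)
    refine ⟨ε, hε, fun J hJ => ?_⟩
    have hJ' : e.symm J ∈ Metric.eball (e.symm I) ε := by
      rw [Metric.mem_eball, edist_comm]
      exact hJ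
    simpa [e] using h hJ'

theorem distTopology_eq_fellTopology :
    distTopology (idealHausdorffDist (X := X)) = fellTopology C(X, ℂ) := by
  have h := induced_closedsFellTopology (homeomorphPrim X)
    (fun C => fell (vanishingIdeal C)) hull_vanishingIdeal
  rw [distTopology_idealHausdorffDist, ← closedsFellTopology_eq_hausdorff, ← h, induced_compose,
    fellTopology]
  congr 1
  funext I
  exact congrArg fell ((closedsEquivIdeals X).apply_symm_apply I)

end Commutative

end FellHausdorff

theorem mainTheorem3 (X : Type u) [MetricSpace X] [CompactSpace X] :
    FellHausdorff.IsExtendedMetric (FellHausdorff.idealHausdorffDist (X := X)) ∧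
    (∀ I J : FellHausdorff.ClosedIdeal C(X, ℂ),
      FellHausdorff.idealHausdorffDist I J ≠ ∞ ↔
        (I = FellHausdorff.ClosedIdeal.whole C(X, ℂ) ↔
          J = FellHausdorff.ClosedIdeal.whole C(X, ℂ))) ∧
    FellHausdorff.distTopology (FellHausdorff.idealHausdorffDist (X := X)) =
      FellHausdorff.fellTopology C(X, ℂ) :=
  ⟨FellHausdorff.isExtendedMetric_idealHausdorffDist,
    FellHausdorff.idealHausdorffDist_ne_top_iff, FellHausdorff.distTopology_eq_fellTopology⟩
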